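/- Let $\mathsf{T}$ be a big tt-category, i.e. a rigidly-compactly generated tensor triangulated category: a compactly generated triangulated category with a symmetric monoidal structure $(\otimes,\mathbf 1)$ such that $\otimes$ is exact and coproduct-preserving in each variable, and such that the compact objects contain $\mathbf 1$, are closed under $\otimes$, and form a rigid tensor category. Let $\mathrm{Loc}^\otimes(\mathsf T)$ be the lattice of localizing tensor-ideals of $\mathsf T$, ordered by inclusion. An idempotent algebra is an object $A$ with a morphism $\eta\colon\mathbf 1\to A$ such that $A\otimes\eta$ is an isomorphism; an idempotent coalgebra is an object $C$ with a morphism $\varepsilon\colon C\to\mathbf 1$ such that $C\otimes\varepsilon$ is an isomorphism. Let $F$ be a spatial frame and let $\tau\colon F\to\mathrm{Loc}^\otimes(\mathsf T)$ be a map preserving arbitrary joins and finite meets which factors through idempotent algebras, i.e. for each $f\in F$ there is an idempotent algebra $A_{\tau f}$ with $\tau f=\{M\mid A_{\tau f}\otimes M\cong 0\}$. Let $C_{\tau f}$ be the corresponding idempotent coalgebra, so that $\tau f=\{M\mid C_{\tau f}\otimes M\cong M\}$; it is given by a triangle $C_{\tau f}\to\mathbf 1\to A_{\tau f}\to$. Let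 $\mathrm{pt}(F)$ be the space of points of $F$, i.e. of frame maps $p\colon F\to\{0,1\}$, with open sets $U_f=\{p\mid p(f)=1\}$ for $f\in F$, and put $V_g=\mathrm{pt}(F)\setminus U_g$. (1) If $f,g,m,n\in F$ satisfy $U_f\cap V_g=U_m\cap V_n$, then $C_{\tau f}\otimes A_{\tau g}\cong C_{\tau m}\otimes A_{\tau n}$, for any choice of representing idempotent (co)algebras. (2) Let $p\in\mathrm{pt}(F)$ be a locally closed point, choose $f,g\in F$ with $\{p\}=U_f\cap V_g$, and put $\Gamma_p=C_{\tau f}\otimes A_{\tau g}$. Up to isomorphism, $\Gamma_p$ does not depend on the choice of $f$ and $g$. (3) If $\tau$ is injective, then $\Gamma_p\neq 0$ for every locally closed point $p$ of $F$. -/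

import Mathlib

open CategoryTheory CategoryTheory.Limits CategoryTheory.MonoidalCategory
open CategoryTheory.Pretriangulated
open scoped ZeroObject

universe w v u

namespace BigTT

section Basic

variable (T : Type u) [Category.{v} T]

/-- An object `X` of a preadditive category is compact if the functor `T(X, -)`, with values in
abelian groups, preserves all set-indexed coproducts. -/
def compactObjects [Preadditive T] : ObjectProperty T := fun X =>
  ∀ J : Type v, PreservesColimitsOfShape (Discrete J) (preadditiveCoyoneda.obj (Opposite.op X))

/-- A functor between triangulated categories is exact if it can be equipped with isomorphisms
of commutation with the shifts for which it preserves distinguished triangles. -/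
def IsExact {C D : Type*} [Category* C] [Category* D]
    [HasZeroObject C] [HasShift C ℤ] [Preadditive C] [∀ n : ℤ, (shiftFunctor C n).Additive]
    [Pretriangulated C]
    [HasZeroObject D] [HasShift D ℤ] [Preadditive D] [∀ n : ℤ, (shiftFunctor D n).Additive]
    [Pretriangulated D] (F : C ⥤ D) : Prop :=
  ∃ _ : F.CommShift ℤ, F.IsTriangulated

/-- A monoidal category is rigid if it is closed and all the natural evaluation maps
`hom(a, 𝟙) ⊗ b ⟶ hom(a, b)` are isomorphisms. -/
def IsRigid (K : Type u) [Category.{v} K] [MonoidalCategory K] : Prop :=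
  ∃ _ : MonoidalClosed K, ∀ a b : K,
    IsIso (MonoidalClosed.curry
      ((α_ a ((ihom a).obj (𝟙_ K)) b).inv ≫ (ihom.ev a).app (𝟙_ K) ▷ b ≫ (λ_ b).hom))

variable [HasZeroObject T] [HasShift T ℤ] [Preadditive T] [∀ n : ℤ, (shiftFunctor T n).Additive]
  [Pretriangulated T]

/-- A triangulated category is compactly generated if it has set-indexed coproducts and there is
a set of compact objects which detects the vanishing of objects. -/
structure IsCompactlyGenerated : Prop where
  hasCoproducts : HasCoproducts.{v} T
  exists_generators : ∃ (ι : Type v) (G : ι → T), (∀ i, compactObjects T (G i)) ∧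
    ∀ M : T, IsZero M ↔ ∀ (i : ι) (n : ℤ) (φ : G i ⟶ M⟦n⟧), φ = 0

variable [MonoidalCategory T]

/-- A big tt-category, i.e. a rigidly-compactly generated tensor triangulated category. -/
class BigTTCategory [IsTriangulated T] [SymmetricCategory T] : Prop where
  compactlyGenerated : IsCompactlyGenerated T
  exact_tensorLeft (X : T) : IsExact (tensorLeft X)
  exact_tensorRight (X : T) : IsExact (tensorRight X)
  coproducts_tensorLeft (X : T) (J : Type v) :
    PreservesColimitsOfShape (Discrete J) (tensorLeft X)
  coproducts_tensorRight (X : T) (J : Type v) :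
    PreservesColimitsOfShape (Discrete J) (tensorRight X)
  compact_isMonoidal : (compactObjects T).IsMonoidal
  rigid : IsRigid (compactObjects T).FullSubcategory

/-- A localizing tensor-ideal: a (replete) full triangulated subcategory closed under set-indexed
coproducts and under tensoring with arbitrary objects. -/
@[ext]
structure LocIdeal where
  carrier : ObjectProperty T
  isClosedUnderIsomorphisms : carrier.IsClosedUnderIsomorphisms
  isTriangulated : carrier.IsTriangulated
  coproducts : ∀ J : Type v, carrier.IsClosedUnderColimitsOfShape (Discrete J)
  tensor : ∀ X M : T, carrier M → carrier (X ⊗ M)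

namespace LocIdeal

variable {T}

instance : PartialOrder (LocIdeal T) := PartialOrder.lift carrier fun _ _ => LocIdeal.ext

lemma le_iff (S S' : LocIdeal T) : S ≤ S' ↔ ∀ M, S.carrier M → S'.carrier M := Iff.rfl

/-- The intersection of a family of localizing tensor-ideals. -/
instance : InfSet (LocIdeal T) where
  sInf 𝒮 :=
    { carrier := fun M => ∀ S ∈ 𝒮, S.carrier M
      isClosedUnderIsomorphisms := ⟨fun e h S hS =>
        S.isClosedUnderIsomorphisms.of_iso e (h S hS)⟩
      isTriangulated :=
        { exists_zero := ⟨0, isZero_zero T, fun S _ =>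
            have := S.isClosedUnderIsomorphisms
            have := S.isTriangulated
            S.carrier.prop_zero⟩
          isStableUnderShiftBy := fun n => ⟨fun M hM S hS =>
            have := S.isTriangulated
            S.carrier.le_shift n M (hM S hS)⟩
          ext₂' := fun Δ hΔ h₁ h₃ => ObjectProperty.le_isoClosure _ _ fun S hS =>
            have := S.isClosedUnderIsomorphisms
            have := S.isTriangulated
            S.carrier.ext_of_isTriangulatedClosed₂ Δ hΔ (h₁ S hS) (h₃ S hS) }
      coproducts := fun J => ⟨fun M ⟨h⟩ S hS =>
        (S.coproducts J).colimitsOfShape_le M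
          ⟨{ toColimitPresentation := h.toColimitPresentation
             prop_diag_obj := fun j => h.prop_diag_obj j S hS }⟩⟩
      tensor := fun X M hM S hS => S.tensor X M (hM S hS) }

lemma isGLB_sInf (𝒮 : Set (LocIdeal T)) : IsGLB 𝒮 (sInf 𝒮) :=
  ⟨fun S hS _ hM => hM S hS, fun _ hS' _ hM _ hS => hS' hS _ hM⟩

/-- The lattice `Loc^⊗(T)`: meets are intersections, and the join of a family is the smallest
localizing tensor-ideal containing all its members. -/
instance : CompleteLattice (LocIdeal T) := completeLatticeOfInf _ isGLB_sInf

end LocIdeal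

end Basic

section Idempotents

variable (T : Type u) [Category.{v} T] [MonoidalCategory T]

/-- An idempotent algebra: an object `A` with `η : 𝟙 ⟶ A` such that `A ⊗ η` is an isomorphism. -/
structure IdempotentAlgebra where
  obj : T
  unit : 𝟙_ T ⟶ obj
  isIso_unit : IsIso (obj ◁ unit)

/-- An idempotent coalgebra: an object `C` with `ε : C ⟶ 𝟙` such that `C ⊗ ε` is an
isomorphism. -/
structure IdempotentCoalgebra where
  obj : T
  counit : obj ⟶ 𝟙_ T
  isIso_counit : IsIso (obj ◁ counit)

variable {T} [HasZeroObject T] [HasShift T ℤ] [Preadditive T]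
  [∀ n : ℤ, (shiftFunctor T n).Additive] [Pretriangulated T]

/-- `A` is the idempotent algebra of the localizing ideal `S`: the ideal consists of the objects
annihilated by `A`. -/
def IdempotentAlgebra.Represents (A : IdempotentAlgebra T) (S : LocIdeal T) : Prop :=
  ∀ M : T, S.carrier M ↔ IsZero (A.obj ⊗ M)

/-- `C` is the idempotent coalgebra of the localizing ideal `S`: the ideal consists of the
`C`-comodules, i.e. of the objects `M` with `C ⊗ M ≅ M`. -/
def IdempotentCoalgebra.Represents (C : IdempotentCoalgebra T) (S : LocIdeal T) : Prop :=
  ∀ M : T, S.carrier M ↔ Nonempty (C.obj ⊗ M ≅ M)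

variable [IsTriangulated T] [SymmetricCategory T] [BigTTCategory T]

lemma isZero_tensor (X : T) {M : T} (hM : IsZero M) : IsZero (X ⊗ M) := by
  obtain ⟨_, _⟩ := BigTTCategory.exact_tensorLeft X
  exact (tensorLeft X).map_isZero hM

/-- The localizing tensor-ideal of the objects annihilated by an idempotent algebra. -/
def IdempotentAlgebra.annihilator (A : IdempotentAlgebra T) : LocIdeal T where
  carrier := fun M => IsZero (A.obj ⊗ M)
  isClosedUnderIsomorphisms := ⟨fun e h => h.of_iso (whiskerLeftIso A.obj e.symm)⟩
  isTriangulated := by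
    obtain ⟨_, _⟩ := BigTTCategory.exact_tensorLeft A.obj
    exact
      { exists_zero := ⟨0, isZero_zero T, isZero_tensor _ (isZero_zero T)⟩
        isStableUnderShiftBy := fun n => ⟨fun M (hM : IsZero _) =>
          ((shiftFunctor T n).map_isZero hM).of_iso
            (((tensorLeft A.obj).commShiftIso n).app M)⟩
        ext₂' := fun Δ hΔ h₁ h₃ => ObjectProperty.le_isoClosure _ _
          (Triangle.isZero₂_of_isZero₁₃ _ ((tensorLeft A.obj).map_distinguished Δ hΔ) h₁ h₃) }
  coproducts := fun J => by
    refine ⟨fun M ⟨h⟩ => ?_⟩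
    have := BigTTCategory.coproducts_tensorLeft A.obj J
    refine (IsZero.iff_id_eq_zero _).2 ((isColimitOfPreserves (tensorLeft A.obj)
      h.isColimit).hom_ext fun j => (h.prop_diag_obj j).eq_of_src _ _)
  tensor := fun X M hM => (isZero_tensor X hM).of_iso
    ((α_ A.obj X M).symm ≪≫ whiskerRightIso (β_ A.obj X) M ≪≫ α_ X A.obj M)

lemma IdempotentAlgebra.represents_annihilator (A : IdempotentAlgebra T) :
    A.Represents A.annihilator := fun _ => Iff.rfl

/-- The fibre of the unit of an idempotent algebra is an idempotent coalgebra, whose comodules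
are the objects annihilated by the algebra. -/
lemma IdempotentAlgebra.exists_coalgebra (A : IdempotentAlgebra T) :
    ∃ C : IdempotentCoalgebra T, C.Represents A.annihilator ∧
      ∃ δ : A.obj ⟶ C.obj⟦(1 : ℤ)⟧, Triangle.mk C.counit A.unit δ ∈ distTriang T := by
  obtain ⟨C, ε, δ, hΔ⟩ := distinguished_cocone_triangle₁ A.unit
  have hAC : IsZero (A.obj ⊗ C) := by
    obtain ⟨_, _⟩ := BigTTCategory.exact_tensorLeft A.obj
    exact Triangle.isZero₁_of_isIso₂ _ ((tensorLeft A.obj).map_distinguished _ hΔ) A.isIso_unit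
  have hCA : IsZero (C ⊗ A.obj) := hAC.of_iso (β_ C A.obj)
  have hε : IsIso (C ◁ ε) := by
    obtain ⟨_, _⟩ := BigTTCategory.exact_tensorLeft C
    exact (Triangle.isZero₃_iff_isIso₁ _ ((tensorLeft C).map_distinguished _ hΔ)).1 hCA
  refine ⟨⟨C, ε, hε⟩, fun M => ⟨fun hM => ?_, fun ⟨e⟩ => ?_⟩, δ, hΔ⟩
  · obtain ⟨_, _⟩ := BigTTCategory.exact_tensorRight M
    have : IsIso (ε ▷ M) :=
      (Triangle.isZero₃_iff_isIso₁ _ ((tensorRight M).map_distinguished _ hΔ)).1 hM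
    exact ⟨asIso (ε ▷ M) ≪≫ λ_ M⟩
  · have h : IsZero (M ⊗ (A.obj ⊗ C)) := isZero_tensor M hAC
    exact h.of_iso (whiskerLeftIso A.obj e.symm ≪≫ (α_ A.obj C M).symm ≪≫ β_ _ M)

end Idempotents

section Points

variable (F : Type w) [Order.Frame F]

/-- A frame is spatial if it is isomorphic to the frame of open subsets of a space. -/
def IsSpatial : Prop :=
  ∃ (X : Type w) (_ : TopologicalSpace X), Nonempty (F ≃o TopologicalSpace.Opens X)

variable {F}

/-- The open set `U_f` of the points `p` of the frame with `p f = 1`. -/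
def U (f : F) : Set (Locale.PT F) := {p | p f}

/-- The closed set `V_g`, the complement of `U_g`. -/
def V (g : F) : Set (Locale.PT F) := (U g)ᶜ

lemma exists_eq_inter {p : Locale.PT F} (hp : IsLocallyClosed ({p} : Set (Locale.PT F))) :
    ∃ fg : F × F, {p} = U fg.1 ∩ V fg.2 := by
  obtain ⟨A, Z, ⟨f, rfl⟩, hZ, h⟩ := hp
  obtain ⟨g, hg⟩ := hZ.isOpen_compl
  refine ⟨(f, g), ?_⟩
  rw [h, V, U, U, hg, compl_compl]

end Points

section Gamma

variable {T : Type u} [Category.{v} T] [MonoidalCategory T] [HasZeroObject T] [HasShift T ℤ]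
  [Preadditive T] [∀ n : ℤ, (shiftFunctor T n).Additive] [Pretriangulated T]
  [IsTriangulated T] [SymmetricCategory T] [BigTTCategory T]
  {F : Type w} [Order.Frame F]

/-- A map to `Loc^⊗(T)` factors through `Idem(T)` if each of its values is the ideal of the
objects annihilated by some idempotent algebra. -/
def FactorsThroughIdem (τ : FrameHom F (LocIdeal T)) : Prop :=
  ∀ f : F, ∃ A : IdempotentAlgebra T, A.annihilator = τ f

variable {τ : FrameHom F (LocIdeal T)} (hτ : FactorsThroughIdem τ)

/-- The idempotent algebra `A_{τ f}`. -/
noncomputable def algebra (f : F) : IdempotentAlgebra T := (hτ f).choose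

/-- The idempotent coalgebra `C_{τ f}`, the fibre of the unit of `A_{τ f}`. -/
noncomputable def coalgebra (f : F) : IdempotentCoalgebra T :=
  (algebra hτ f).exists_coalgebra.choose

lemma algebra_represents (f : F) : (algebra hτ f).Represents (τ f) := by
  rw [← (hτ f).choose_spec]
  exact (algebra hτ f).represents_annihilator

lemma coalgebra_represents (f : F) : (coalgebra hτ f).Represents (τ f) := by
  rw [← (hτ f).choose_spec]
  exact (algebra hτ f).exists_coalgebra.choose_spec.1

/-- The object `Γ_p = C_{τ f} ⊗ A_{τ g}` at a locally closed point `p`, for a chosen pair `f, g`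
with `{p} = U_f ∩ V_g`. -/
noncomputable def Gamma (p : Locale.PT F) (hp : IsLocallyClosed ({p} : Set (Locale.PT F))) : T :=
  (coalgebra hτ (exists_eq_inter hp).choose.1).obj ⊗
    (algebra hτ (exists_eq_inter hp).choose.2).obj

end Gamma

end BigTT

/-! Inclusions of locally closed sets of points become lattice relations: by spatiality, `U f ∩ V g
⊆ U m` gives `f ≤ m ⊔ g`, and `U f ∩ V g ⊆ V n` gives `f ⊓ n ≤ g`. Since `τ` preserves binary joins
and meets, the same relations hold between the ideals. The first relation puts `C ⊗ A` in `τ m`,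
because tensoring with `A` kills `τ g`; hence `C'` fixes `C ⊗ A`. The second makes `C ⊗ A`
annihilate `τ n`, so `A'` fixes it as well. Thus `C ⊗ A` absorbs `C'` and `A'`
(`nonempty_iso_tensor_tensor`), and by symmetry both products are isomorphic to the product of all
four objects. For nonvanishing, `C ⊗ A = 0` forces `τ f ≤ τ g`; injectivity then gives `f ≤ g`,
which no point of `U f ∩ V g` allows. -/

namespace BigTT

section PointsOfFrames

variable {F : Type w} [Order.Frame F]

/-- In a spatial frame, inclusion of open sets of points reflects the order. -/
lemma le_of_U_subset (hF : IsSpatial F) {a b : F} (h : U a ⊆ U b) : a ≤ b := by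
  obtain ⟨X, _, ⟨e⟩⟩ := hF
  rw [← e.le_iff_le]
  intro x hx
  -- The point of the frame induced by `x`: membership of `x` in the open set attached to `c`.
  let p : Locale.PT F :=
    { toFun := fun c => x ∈ e c
      map_inf' := fun c d => by simp
      map_top' := by simp
      map_sSup' := fun s => by
        simp only [map_sSup, TopologicalSpace.Opens.mem_sSup, sSup_Prop_eq, Set.mem_image]
        simp }
  exact h (show p ∈ U a from hx)

lemma U_sup (a b : F) : U (a ⊔ b) = U a ∪ U b := by
  ext p
  simp only [U, Set.mem_ofPred_eq, Set.mem_union, map_sup]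
  rfl

lemma U_inf (a b : F) : U (a ⊓ b) = U a ∩ U b := by
  ext p
  simp only [U, Set.mem_ofPred_eq, Set.mem_inter_iff, map_inf]
  rfl

lemma le_sup_of_inter_subset (hF : IsSpatial F) {f g m : F} (h : U f ∩ V g ⊆ U m) :
    f ≤ m ⊔ g := by
  refine le_of_U_subset hF ?_
  rw [U_sup]
  intro p hp
  by_cases hg : p ∈ U g
  · exact Or.inr hg
  · exact Or.inl (h ⟨hp, hg⟩)

lemma inf_le_of_inter_subset (hF : IsSpatial F) {f g n : F} (h : U f ∩ V g ⊆ V n) :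
    f ⊓ n ≤ g := by
  refine le_of_U_subset hF ?_
  rw [U_inf]
  intro p hp
  by_contra hg
  exact h ⟨hp.1, hg⟩ hp.2

end PointsOfFrames

section TensorIdeals

variable {T : Type u} [Category.{v} T] [MonoidalCategory T] [HasZeroObject T] [HasShift T ℤ]
  [Preadditive T] [∀ n : ℤ, (shiftFunctor T n).Additive] [Pretriangulated T]

lemma LocIdeal.of_iso (S : LocIdeal T) {M N : T} (e : M ≅ N) (h : S.carrier M) : S.carrier N :=
  S.isClosedUnderIsomorphisms.of_iso e h

lemma LocIdeal.mem_inf (S S' : LocIdeal T) (M : T) (h : S.carrier M) (h' : S'.carrier M) :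
    (S ⊓ S').carrier M := by
  intro R hR
  rcases hR with rfl | rfl
  exacts [h, h']

lemma IdempotentCoalgebra.Represents.mem_self {C : IdempotentCoalgebra T} {S : LocIdeal T}
    (h : C.Represents S) : S.carrier C.obj := by
  have := C.isIso_counit
  exact (h _).2 ⟨asIso (C.obj ◁ C.counit) ≪≫ ρ_ C.obj⟩

lemma LocIdeal.tensor_right [SymmetricCategory T] (S : LocIdeal T) {M : T}
    (hM : S.carrier M) (X : T) : S.carrier (M ⊗ X) :=
  S.of_iso (β_ X M) (S.tensor X M hM)

/-- A pair with `C ⊗ A = 0` forces an inclusion of the represented ideals. -/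
lemma le_of_isZero_tensor [SymmetricCategory T] {S R : LocIdeal T}
    {C : IdempotentCoalgebra T} {A : IdempotentAlgebra T} (hC : C.Represents S) (hA : A.Represents R)
    (h : IsZero (C.obj ⊗ A.obj)) : S ≤ R := by
  intro M hM
  obtain ⟨e⟩ := (hC M).1 hM
  -- `A` kills `C`, so `C` lies in `R`, and with it `C ⊗ M ≅ M`.
  exact R.of_iso e (R.tensor_right ((hA _).2 (h.of_iso (β_ _ _))) M)

variable [IsTriangulated T] [SymmetricCategory T] [BigTTCategory T]

/-- The localizing tensor-ideal of the objects whose tensor product with `X` lies in `S`. -/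
def LocIdeal.comapTensor (S : LocIdeal T) (X : T) : LocIdeal T where
  carrier := fun M => S.carrier (X ⊗ M)
  isClosedUnderIsomorphisms := ⟨fun e h => S.of_iso (whiskerLeftIso X e) h⟩
  isTriangulated := by
    obtain ⟨_, _⟩ := BigTTCategory.exact_tensorLeft X
    have := S.isClosedUnderIsomorphisms
    have := S.isTriangulated
    exact
      { exists_zero := ⟨0, isZero_zero T,
          S.carrier.prop_of_isZero (isZero_tensor X (isZero_zero T))⟩
        isStableUnderShiftBy := fun n => ⟨fun M hM =>
          S.of_iso (((tensorLeft X).commShiftIso n).app M).symm (S.carrier.le_shift n _ hM)⟩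
        ext₂' := fun Δ hΔ h₁ h₃ => ObjectProperty.le_isoClosure _ _
          (S.carrier.ext_of_isTriangulatedClosed₂ _
            ((tensorLeft X).map_distinguished Δ hΔ) h₁ h₃) }
  coproducts := fun J => by
    refine ⟨fun M ⟨h⟩ => ?_⟩
    have := BigTTCategory.coproducts_tensorLeft X J
    exact (S.coproducts J).colimitsOfShape_le (X ⊗ M)
      ⟨{ toColimitPresentation := h.toColimitPresentation.map (tensorLeft X)
         prop_diag_obj := h.prop_diag_obj }⟩
  tensor := fun Y M hM => S.of_iso
    ((α_ Y X M).symm ≪≫ whiskerRightIso (β_ Y X) M ≪≫ α_ X Y M) (S.tensor Y _ hM)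

/-- Localizing away from `S'` sends the join `S ⊔ S'` into `S`. -/
lemma IdempotentAlgebra.Represents.tensor_mem_of_mem_sup {A : IdempotentAlgebra T}
    {S S' : LocIdeal T} (hA : A.Represents S') {M : T} (hM : (S ⊔ S').carrier M) :
    S.carrier (A.obj ⊗ M) := by
  -- The join is the least ideal above `S` and `S'`, so its elements need no explicit description:
  -- it suffices that the preimage of `S` under `A ⊗ -` is an ideal containing both.
  have h : S ⊔ S' ≤ S.comapTensor A.obj := by
    refine sup_le (fun N hN => S.tensor _ _ hN) (fun N hN => ?_)
    have := S.isClosedUnderIsomorphisms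
    have := S.isTriangulated
    exact S.carrier.prop_of_isZero ((hA N).1 hN)
  exact h M hM

/-- Allows the coalgebra built from the unit of `A` to be used for any ideal that `A` represents. -/
lemma IdempotentAlgebra.Represents.annihilator_eq {A : IdempotentAlgebra T} {S : LocIdeal T}
    (hA : A.Represents S) : A.annihilator = S :=
  LocIdeal.ext (funext fun M => propext (hA M).symm)

/-- If `M ⊗ -` kills the ideal represented by `A`, then `M` is `A`-local. -/
lemma IdempotentAlgebra.Represents.nonempty_tensor_iso {A : IdempotentAlgebra T}
    {S : LocIdeal T} (hA : A.Represents S) {M : T}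
    (hM : ∀ N, S.carrier N → IsZero (M ⊗ N)) : Nonempty (M ⊗ A.obj ≅ M) := by
  obtain ⟨C, hC, δ, hΔ⟩ := A.exists_coalgebra
  rw [hA.annihilator_eq] at hC
  obtain ⟨_, _⟩ := BigTTCategory.exact_tensorLeft M
  -- The fibre of this map is `M ⊗ C`, which vanishes because `C` lies in `S`.
  have : IsIso (M ◁ A.unit) :=
    (Triangle.isZero₁_iff_isIso₂ _ ((tensorLeft M).map_distinguished _ hΔ)).1 (hM _ hC.mem_self)
  exact ⟨(asIso (M ◁ A.unit)).symm ≪≫ ρ_ M⟩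

/-- Tensoring `C ⊗ A` with another pair `C'`, `A'` does not change it, as soon as the ideals satisfy
`S ≤ S' ⊔ R` and `S ⊓ R' ≤ R`. -/
lemma nonempty_iso_tensor_tensor {S R S' R' : LocIdeal T} (h : S ≤ S' ⊔ R) (h' : S ⊓ R' ≤ R)
    {C C' : IdempotentCoalgebra T} {A A' : IdempotentAlgebra T}
    (hC : C.Represents S) (hA : A.Represents R) (hC' : C'.Represents S')
    (hA' : A'.Represents R') :
    Nonempty (C.obj ⊗ A.obj ≅ (C'.obj ⊗ C.obj) ⊗ (A.obj ⊗ A'.obj)) := by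
  have hmem : S'.carrier (C.obj ⊗ A.obj) :=
    S'.of_iso (β_ _ _) (hA.tensor_mem_of_mem_sup (h _ hC.mem_self))
  obtain ⟨e⟩ := (hC' _).1 hmem
  -- For `N` in `R'`, the object `C ⊗ N` lies in `S ⊓ R' ≤ R` and is therefore killed by `A`.
  have hzero : ∀ N, R'.carrier N → IsZero ((C.obj ⊗ A.obj) ⊗ N) := fun N hN =>
    ((hA _).1 (h' _ (S.mem_inf R' _ (S.tensor_right hC.mem_self N)
      (R'.tensor C.obj N hN)))).of_iso
      (whiskerRightIso (β_ C.obj A.obj) N ≪≫ α_ A.obj C.obj N)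
  obtain ⟨e'⟩ := hA'.nonempty_tensor_iso hzero
  exact ⟨e.symm ≪≫ whiskerLeftIso C'.obj (e'.symm ≪≫ α_ _ _ _) ≪≫ (α_ _ _ _).symm⟩

/-- The object `C ⊗ A` only depends on the locally closed set of points. -/
lemma nonempty_iso_of_inter_eq {F : Type w} [Order.Frame F] (hF : IsSpatial F)
    (τ : FrameHom F (LocIdeal T)) {f g m n : F} (h : U f ∩ V g = U m ∩ V n)
    {C C' : IdempotentCoalgebra T} {A A' : IdempotentAlgebra T}
    (hC : C.Represents (τ f)) (hA : A.Represents (τ g))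
    (hC' : C'.Represents (τ m)) (hA' : A'.Represents (τ n)) :
    Nonempty (C.obj ⊗ A.obj ≅ C'.obj ⊗ A'.obj) := by
  have hsup {a b c : F} (hle : a ≤ b ⊔ c) : τ a ≤ τ b ⊔ τ c := by
    rw [← map_sup]
    exact OrderHomClass.mono τ hle
  have hinf {a b c : F} (hle : a ⊓ b ≤ c) : τ a ⊓ τ b ≤ τ c := by
    rw [← map_inf]
    exact OrderHomClass.mono τ hle
  obtain ⟨e⟩ := nonempty_iso_tensor_tensor
    (hsup (le_sup_of_inter_subset hF (h.subset.trans Set.inter_subset_left)))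
    (hinf (inf_le_of_inter_subset hF (h.subset.trans Set.inter_subset_right))) hC hA hC' hA'
  obtain ⟨e'⟩ := nonempty_iso_tensor_tensor
    (hsup (le_sup_of_inter_subset hF (h.superset.trans Set.inter_subset_left)))
    (hinf (inf_le_of_inter_subset hF (h.superset.trans Set.inter_subset_right))) hC' hA' hC hA
  -- The two fourfold products differ only by braidings.
  exact ⟨e ≪≫ (β_ C'.obj C.obj ⊗ᵢ β_ A.obj A'.obj) ≪≫ e'.symm⟩

end TensorIdeals

end BigTT

theorem mainTheorem8
    {T : Type u} [Category.{v} T] [MonoidalCategory T] [HasZeroObject T] [HasShift T ℤ]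
    [Preadditive T] [∀ n : ℤ, (shiftFunctor T n).Additive] [Pretriangulated T]
    [IsTriangulated T] [SymmetricCategory T] [BigTT.BigTTCategory T]
    {F : Type w} [Order.Frame F] (hF : BigTT.IsSpatial F)
    (τ : FrameHom F (BigTT.LocIdeal T)) (hτ : BigTT.FactorsThroughIdem τ) :
    (∀ f g m n : F, BigTT.U f ∩ BigTT.V g = BigTT.U m ∩ BigTT.V n →
      ∀ (C C' : BigTT.IdempotentCoalgebra T) (A A' : BigTT.IdempotentAlgebra T),
        C.Represents (τ f) → A.Represents (τ g) → C'.Represents (τ m) → A'.Represents (τ n) →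
          Nonempty (C.obj ⊗ A.obj ≅ C'.obj ⊗ A'.obj)) ∧
    (∀ (p : Locale.PT F) (hp : IsLocallyClosed ({p} : Set (Locale.PT F))) (f g : F),
      {p} = BigTT.U f ∩ BigTT.V g →
      ∀ (C : BigTT.IdempotentCoalgebra T) (A : BigTT.IdempotentAlgebra T),
        C.Represents (τ f) → A.Represents (τ g) →
          Nonempty (BigTT.Gamma hτ p hp ≅ C.obj ⊗ A.obj)) ∧
    (Function.Injective τ →
      ∀ (p : Locale.PT F) (hp : IsLocallyClosed ({p} : Set (Locale.PT F))),
        ¬ IsZero (BigTT.Gamma hτ p hp)) := by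
  refine ⟨fun f g m n h C C' A A' hC hA hC' hA' =>
      BigTT.nonempty_iso_of_inter_eq hF τ h hC hA hC' hA',
    fun p hp f g h C A hC hA => ?_, fun hinj p hp hzero => ?_⟩
  · exact BigTT.nonempty_iso_of_inter_eq hF τ
      ((BigTT.exists_eq_inter hp).choose_spec.symm.trans h)
      (BigTT.coalgebra_represents hτ _) (BigTT.algebra_represents hτ _) hC hA
  · have hle := BigTT.le_of_isZero_tensor (BigTT.coalgebra_represents hτ _)
      (BigTT.algebra_represents hτ _) hzero
    have hp' := (BigTT.exists_eq_inter hp).choose_spec.subset (Set.mem_singleton p)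
    -- An injective map preserving meets reflects the order: `τ (f ⊓ g) = τ f` yields `f ⊓ g = f`.
    have hfg := inf_eq_left.1 (hinj ((map_inf τ _ _).trans (inf_eq_left.2 hle)))
    exact hp'.2 (OrderHomClass.mono p hfg hp'.1)
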